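/- All graphs are finite and simple. A \emph{Grundy coloring} of a graph $G$ is a partition of $V(G)$ into non-empty independent sets $C_1,\dots,C_k$ such that for all $i<j$ every vertex of $C_j$ has a neighbor in $C_i$; the Grundy number $\Gamma(G)$ is the largest such $k$. A \emph{color-dominating coloring} of $G$ is a partition of $V(G)$ into independent sets $C_1,\dots,C_k$ such that every $C_i$ contains a vertex that has a neighbor in $C_j$ for each $j\ne i$; the ${\rm b}$-chromatic number ${\rm b}(G)$ is the largest such $k$. A family $\mathcal F$ of graphs is \emph{$(\Gamma,b)$-bounded} if there is a function $f:\mathbb N\to\mathbb N$ such that $\Gamma(G)\le f({\rm b}(G))$ for every $G\in\mathcal F$. Let $P_k$ be the path on $k$ vertices and $Forb(P_k)$ the family of all graphs that do not contain $P_k$ as an induced subgraph. \textbf{Proposition.} (i) For every natural number $k$, the family $Forb(P_k)$ is $(\Gamma,b)$-bounded if and only if $k\le 5$. (ii) For every $t\ge 2$, let $B_t$ be the graph obtained from the complete bipartite graph $K_{t,t}$ by removing the edges of a matching of size $t-1$. Then $B_t\in Forb(P_k)$ for every $k\ge 6$, $\Gamma(B_t)=t+1$ and ${\rm b}(B_t)=2$.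 -/

import Mathlib

universe u v

/-- `C` is a Grundy (First-Fit) coloring of `G` with the `k` colors `0 < 1 < ⋯ < k - 1`: a proper
coloring in which every color is used and every vertex has a neighbor in each color class smaller
than its own. -/
def IsGrundyColoring {V : Type u} {G : SimpleGraph V} {k : ℕ} (C : G.Coloring (Fin k)) : Prop :=
  Function.Surjective C ∧
    ∀ i j : Fin k, i < j → ∀ v : V, C v = j → ∃ w : V, G.Adj v w ∧ C w = i

/-- `C` is a color-dominating coloring (b-coloring) of `G`: a proper coloring in which every color
class contains a vertex having a neighbor in every other color class. -/
def IsColorDominatingColoring {V : Type u} {G : SimpleGraph V} {k : ℕ}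
    (C : G.Coloring (Fin k)) : Prop :=
  ∀ i : Fin k, ∃ v : V, C v = i ∧ ∀ j : Fin k, j ≠ i → ∃ w : V, G.Adj v w ∧ C w = j

/-- The Grundy number `Γ(G)`. Used for finite graphs only, where the supremum is a maximum. -/
noncomputable def grundyNumber {V : Type u} (G : SimpleGraph V) : ℕ :=
  sSup {k : ℕ | ∃ C : G.Coloring (Fin k), IsGrundyColoring C}

/-- The b-chromatic number `b(G)`. Used for finite graphs only, where the supremum is a maximum. -/
noncomputable def bChromaticNumber {V : Type u} (G : SimpleGraph V) : ℕ :=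
  sSup {k : ℕ | ∃ C : G.Coloring (Fin k), IsColorDominatingColoring C}

/-- A finite simple graph together with its vertex type. -/
structure FinGraph : Type (u + 1) where
  /-- the vertices -/
  V : Type u
  /-- there are finitely many vertices -/
  finite : Finite V
  /-- the graph -/
  graph : SimpleGraph V

/-- `Forb(H)`: the family of all finite graphs without an induced subgraph isomorphic to `H`. -/
def Forb {W : Type v} (H : SimpleGraph W) : Set FinGraph.{u} :=
  {G | ¬ SimpleGraph.IsIndContained H G.graph}

/-- A family of finite graphs is `(Γ, b)`-bounded if `Γ(G) ≤ f(b(G))` on it for some `f`. -/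
def IsGammaBBounded (F : Set FinGraph.{u}) : Prop :=
  ∃ f : ℕ → ℕ, ∀ G ∈ F, grundyNumber G.graph ≤ f (bChromaticNumber G.graph)

/-- The complete bipartite graph `K_{t,t}` with the edges of a matching of size `t - 1` removed:
the `i`-th vertices of the two sides are separated, for all `i` but the last one. -/
def bipartiteMinusMatching (t : ℕ) : SimpleGraph (Fin t ⊕ Fin t) :=
  (completeBipartiteGraph (Fin t) (Fin t)).deleteEdges
    {e | ∃ i : Fin t, (i : ℕ) + 1 < t ∧ e = s(Sum.inl i, Sum.inr i)}

/-!
The clique number is at most the chromatic number, which is at most the b-chromatic number, so the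
family `Forb(P₅)` is `(Γ, b)`-bounded once the Grundy number of a `P₅`-free graph is bounded in terms
of its clique number (`exists_bound_card_isWall`). This is proved by induction on the clique number,
for *walls*: sets `X` of vertices in which every vertex sees all smaller colors of a set `T`.

By induction, a wall inside a neighborhood `N(x)` has at most `m` colors. Let `x` be a vertex of the
largest color of a wall with very many colors. By Ramsey's theorem there are either `m + 1` colors
such that, for any two of them, every vertex of `N(x)` of the larger color sees the smaller one
inside `N(x)`, and then `N(x)` contains too large a wall, or many colors such that, for any two of
them, this fails at some vertex. In the second case `P₅`-freeness makes the non-neighbors `M` of `x`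
a wall for those colors (`SeesLower.diff_neighborSet`). If every vertex of `N(x)` missed only few
smaller colors in `N(x)`, then a greedy choice of colors would again give too large a wall in `N(x)`
(`exists_isWall_of_card_missing_le`). So some `y` in `N(x)` misses many colors in `N(x)`, hence sees
them in `M`. The same dichotomy for `y` and `M` yields `m + 2` colors for which `U = M \ N(y)` is a
wall, and a vertex `t` in `N(y) ∩ M` with a neighbor in `U`. A component of `U` that meets `N(t)`
lies inside `N(t)`, since otherwise there is an induced path `x - y - t - v - u`. So `N(t)` contains
a wall with `m + 1` colors, a contradiction.

For `k ≥ 6` the graphs `B_t` are counterexamples. Each vertex has at most one non-neighbor on the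
other side, which excludes an induced `P₆`, and the last vertices of the two sides see the whole
other side, which excludes a color-dominating coloring with three colors.
-/

/-! ### Preliminaries: Ramsey's theorem for pairs, and induced paths on five vertices -/

open Finset in
/-- Ramsey's theorem for pairs of natural numbers and two colors. -/
theorem exists_ramsey_bound (a b : ℕ) : ∃ n : ℕ, ∀ (r : ℕ → ℕ → Prop) (S : Finset ℕ), n ≤ #S →
    (∃ T ⊆ S, #T = a ∧ ∀ i ∈ T, ∀ j ∈ T, i < j → r i j) ∨
    (∃ T ⊆ S, #T = b ∧ ∀ i ∈ T, ∀ j ∈ T, i < j → ¬ r i j) := by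
  classical
  induction a generalizing b with
  | zero => exact ⟨0, fun r S _ => .inl ⟨∅, by simp⟩⟩
  | succ a iha =>
    induction b with
    | zero => exact ⟨0, fun r S _ => .inr ⟨∅, by simp⟩⟩
    | succ b ihb =>
      obtain ⟨n₁, h₁⟩ := iha (b + 1)
      obtain ⟨n₂, h₂⟩ := ihb
      refine ⟨n₁ + n₂ + 1, fun r S hS => ?_⟩
      have hne : S.Nonempty := card_pos.1 (by omega)
      have hcard := card_erase_of_mem (S.max'_mem hne)
      have hlt : ∀ i ∈ S.erase (S.max' hne), i < S.max' hne := fun i hi =>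
        S.lt_max'_of_mem_erase_max' hne hi
      have hmem := S.max'_mem hne
      generalize S.max' hne = x at *
      have hsplit := card_filter_add_card_filter_not (s := S.erase x) (fun i => r i x)
      -- a set that is monochromatic in the right color below the maximum extends by the maximum
      have extend : ∀ (q : ℕ → ℕ → Prop) (T : Finset ℕ),
          (∀ i ∈ T, i ∈ S.erase x ∧ q i x) →
          (∀ i ∈ T, ∀ j ∈ T, i < j → q i j) →
          insert x T ⊆ S ∧ #(insert x T) = #T + 1 ∧
            ∀ i ∈ insert x T, ∀ j ∈ insert x T, i < j → q i j := by
        intro q T hT' hq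
        have hx : x ∉ T := fun hx => by simpa using (hT' x hx).1
        refine ⟨insert_subset hmem fun i hi => mem_of_mem_erase (hT' i hi).1,
          card_insert_of_notMem hx, fun i hi j hj hij => ?_⟩
        rcases mem_insert.1 hi with hix | hi <;> rcases mem_insert.1 hj with hjx | hj
        · omega
        · have := hlt j (hT' j hj).1
          omega
        · exact hjx ▸ (hT' i hi).2
        · exact hq i hi j hj hij
      have hsub : ∀ q : ℕ → Prop, [DecidablePred q] → (S.erase x).filter q ⊆ S := fun q _ =>
        (filter_subset _ _).trans (erase_subset _ _)
      rcases le_or_gt n₁ #((S.erase x).filter fun i => r i x) with h | h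
      · rcases h₁ r _ h with ⟨T, hT, hc, hr⟩ | ⟨T, hT, hc, hr⟩
        · obtain ⟨e₁, e₂, e₃⟩ := extend r T (fun i hi => mem_filter.1 (hT hi)) hr
          exact .inl ⟨_, e₁, by omega, e₃⟩
        · exact .inr ⟨T, hT.trans (hsub _), hc, hr⟩
      · rcases h₂ r ((S.erase x).filter fun i => ¬ r i x) (by omega) with
          ⟨T, hT, hc, hr⟩ | ⟨T, hT, hc, hr⟩
        · exact .inl ⟨T, hT.trans (hsub _), hc, hr⟩
        · obtain ⟨e₁, e₂, e₃⟩ := extend (fun i j => ¬ r i j) T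
            (fun i hi => mem_filter.1 (hT hi)) hr
          exact .inr ⟨_, e₁, by omega, e₃⟩

/-- Five vertices with the adjacencies of `P₅` are distinct, so they induce a `P₅`. -/
theorem isIndContained_pathGraph_five {V : Type*} {G : SimpleGraph V} {a b c d e : V}
    (hab : G.Adj a b) (hbc : G.Adj b c) (hcd : G.Adj c d) (hde : G.Adj d e)
    (hac : ¬ G.Adj a c) (had : ¬ G.Adj a d) (hae : ¬ G.Adj a e)
    (hbd : ¬ G.Adj b d) (hbe : ¬ G.Adj b e) (hce : ¬ G.Adj c e) :
    (SimpleGraph.pathGraph 5).IsIndContained G := by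
  have n₁ := hab.ne
  have n₂ := hbc.ne
  have n₃ := hcd.ne
  have n₄ := hde.ne
  have n₅ : a ≠ c := by rintro rfl; exact had hcd
  have n₆ : a ≠ d := by rintro rfl; exact hac hcd.symm
  have n₇ : a ≠ e := by rintro rfl; exact had hde.symm
  have n₈ : b ≠ d := by rintro rfl; exact hbe hde
  have n₉ : b ≠ e := by rintro rfl; exact hce hbc.symm
  have n₁₀ : c ≠ e := by rintro rfl; exact hbe hbc
  refine ⟨⟨⟨![a, b, c, d, e], fun i j h => ?_⟩, fun {i j} => ?_⟩⟩
  · fin_cases i <;> fin_cases j <;> simp_all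
  · change G.Adj (![a, b, c, d, e] i) (![a, b, c, d, e] j) ↔ _
    fin_cases i <;> fin_cases j <;>
      simp_all [SimpleGraph.pathGraph_adj, SimpleGraph.adj_comm]

/-! ### Walls and missing colors -/

section Walls

variable {V : Type*}

/-- Every vertex of `X` with color in `T` has neighbors in `X` of all smaller colors in `T`: the
coloring `c` satisfies the Grundy condition on the vertices of `X` with color in `T`. -/
def SeesLower (G : SimpleGraph V) (c : V → ℕ) (X : Set V) (T : Finset ℕ) : Prop :=
  ∀ v ∈ X, c v ∈ T → ∀ i ∈ T, i < c v → ∃ u ∈ X, G.Adj v u ∧ c u = i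

/-- A *wall*: each color of `T` occurs on `X`, and `c` satisfies the Grundy condition there. -/
def IsWall (G : SimpleGraph V) (c : V → ℕ) (X : Set V) (T : Finset ℕ) : Prop :=
  (∀ i ∈ T, ∃ v ∈ X, c v = i) ∧ SeesLower G c X T

open Classical in
/-- The colors of `T` smaller than the color of `v` that do not occur on a neighbor of `v` in
`N`. -/
noncomputable def missing (G : SimpleGraph V) (c : V → ℕ) (N : Set V) (T : Finset ℕ) (v : V) :
    Finset ℕ :=
  T.filter fun i => i < c v ∧ ¬ ∃ u ∈ N, G.Adj v u ∧ c u = i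

theorem mem_missing {G : SimpleGraph V} {c : V → ℕ} {N : Set V} {T : Finset ℕ} {v : V} {i : ℕ} :
    i ∈ missing G c N T v ↔ i ∈ T ∧ i < c v ∧ ¬ ∃ u ∈ N, G.Adj v u ∧ c u = i := by
  simp [missing]

theorem SeesLower.subset {G : SimpleGraph V} {c : V → ℕ} {X : Set V} {S T : Finset ℕ}
    (h : SeesLower G c X S) (hT : T ⊆ S) : SeesLower G c X T :=
  fun v hv hc i hi => h v hv (hT hc) i (hT hi)

end Walls

open Finset in
/-- The colors of a wall are chosen from the largest down: `A` collects the vertices chosen so far,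
and the next color `i` at most doubles `A` and rules out the colors missing at the new vertices. -/
theorem exists_seesLower_of_card_missing_le (L m s : ℕ) : ∃ n : ℕ,
    ∀ {V : Type u} (G : SimpleGraph V) (c : V → ℕ) (N : Set V) (T : Finset ℕ),
    (∀ v ∈ N, c v ∈ T → #(missing G c N T v) ≤ L) →
    ∀ (A : Finset V) (R : Finset ℕ), #A ≤ s → R ⊆ T → n ≤ #R →
    (∀ v ∈ A, ∀ i ∈ R, ∃ u ∈ N, G.Adj v u ∧ c u = i) →
    ∃ T' ⊆ R, #T' = m ∧ ∃ B ⊆ N, (∀ v ∈ B, c v ∈ T') ∧ SeesLower G c B T' ∧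
      ∀ v ∈ A, ∀ i ∈ T', ∃ u ∈ B, G.Adj v u ∧ c u = i := by
  classical
  induction m generalizing s with
  | zero => exact ⟨0, fun G c N T _ A R _ _ _ _ => ⟨∅, by simp, rfl, ∅, by simp [SeesLower]⟩⟩
  | succ m ih =>
    obtain ⟨n, hn⟩ := ih (2 * s)
    refine ⟨n + 1 + s * L, fun G c N T hL A R hA hRT hR hsee => ?_⟩
    have hne : R.Nonempty := card_pos.1 (by omega)
    have hlt : ∀ i ∈ R.erase (R.max' hne), i < R.max' hne := fun i hi =>
      R.lt_max'_of_mem_erase_max' hne hi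
    have hmem := R.max'_mem hne
    generalize R.max' hne = x at *
    choose! f hfN hfadj hfc using fun v hv => hsee v hv x hmem
    set A₁ := A.image f
    have hA₁ : #A₁ ≤ #A := card_image_le
    have hA₁N : ∀ v ∈ A₁, v ∈ N ∧ c v = x := fun v hv => by
      obtain ⟨w, hw, rfl⟩ := mem_image.1 hv
      exact ⟨hfN w hw, hfc w hw⟩
    set D := A₁.biUnion (missing G c N T)
    have hD : #D ≤ s * L := by
      refine (card_biUnion_le_card_mul A₁ _ L fun v hv => hL v (hA₁N v hv).1 ?_).trans
        (Nat.mul_le_mul_right L (hA₁.trans hA))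
      rw [(hA₁N v hv).2]
      exact hRT hmem
    have hR₁ : n ≤ #((R.erase x) \ D) := by
      have := le_card_sdiff D (R.erase x)
      rw [card_erase_of_mem hmem] at this
      omega
    obtain ⟨T', hT', hcard, B, hBN, hBc, hBsee, hAB⟩ := hn G c N T hL (A ∪ A₁) _
      ((card_union_le _ _).trans (by omega))
      ((sdiff_subset.trans (erase_subset _ _)).trans hRT) hR₁ (fun v hv i hi => by
        obtain ⟨hi, hiD⟩ := mem_sdiff.1 hi
        rcases mem_union.1 hv with hv | hv
        · exact hsee v hv i (mem_of_mem_erase hi)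
        · by_contra hno
          refine hiD (mem_biUnion.2 ⟨v, hv, mem_missing.2 ⟨hRT (mem_of_mem_erase hi), ?_, hno⟩⟩)
          rw [(hA₁N v hv).2]
          exact hlt i hi)
    have hT'R : ∀ i ∈ T', i ∈ R ∧ i < x := fun i hi =>
      have := (mem_sdiff.1 (hT' hi)).1
      ⟨mem_of_mem_erase this, hlt i this⟩
    have hxT' : x ∉ T' := fun h => lt_irrefl x (hT'R x h).2
    refine ⟨insert x T', insert_subset hmem fun i hi => (hT'R i hi).1,
      by rw [card_insert_of_notMem hxT', hcard], B ∪ ↑A₁, ?_, ?_, ?_, ?_⟩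
    · exact Set.union_subset hBN fun v hv => (hA₁N v hv).1
    · rintro v (hv | hv)
      · exact mem_insert_of_mem (hBc v hv)
      · exact mem_insert.2 (.inl (hA₁N v hv).2)
    · rintro v (hv | hv) - i hi hic
      · have hvx := (hT'R _ (hBc v hv)).2
        obtain ⟨u, hu, h⟩ := hBsee v hv (hBc v hv) i
          ((mem_insert.1 hi).resolve_left (by omega)) hic
        exact ⟨u, .inl hu, h⟩
      · have hvx := (hA₁N v hv).2
        obtain ⟨u, hu, h⟩ := hAB v (mem_union_right _ hv) i
          ((mem_insert.1 hi).resolve_left (by omega))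
        exact ⟨u, .inl hu, h⟩
    · intro v hv i hi
      rcases mem_insert.1 hi with rfl | hi
      · exact ⟨f v, .inr (mem_coe.2 (mem_image_of_mem f hv)), hfadj v hv, hfc v hv⟩
      · obtain ⟨u, hu, h⟩ := hAB v (mem_union_left _ hv) i hi
        exact ⟨u, .inl hu, h⟩

open Finset in
/-- If no vertex misses more than `L` smaller colors, and there are enough colors, then some `m` of
them carry a wall. -/
theorem exists_isWall_of_card_missing_le (L m : ℕ) : ∃ n : ℕ,
    ∀ {V : Type u} (G : SimpleGraph V) (c : V → ℕ) (N : Set V) (T : Finset ℕ),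
    (∀ i ∈ T, ∃ v ∈ N, c v = i) → (∀ v ∈ N, c v ∈ T → #(missing G c N T v) ≤ L) → n ≤ #T →
    ∃ T' ⊆ T, #T' = m ∧ ∃ B ⊆ N, IsWall G c B T' := by
  classical
  obtain ⟨n, hn⟩ := exists_seesLower_of_card_missing_le.{u} L m 1
  refine ⟨n + 1 + L, fun G c N T hfull hL hT => ?_⟩
  have hne : T.Nonempty := card_pos.1 (by omega)
  have hlt : ∀ i ∈ T.erase (T.max' hne), i < T.max' hne := fun i hi =>
    T.lt_max'_of_mem_erase_max' hne hi
  have hmem := T.max'_mem hne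
  generalize T.max' hne = x at *
  obtain ⟨v, hvN, rfl⟩ := hfull x hmem
  have hcard : n ≤ #((T.erase (c v)) \ missing G c N T v) := by
    have := le_card_sdiff (missing G c N T v) (T.erase (c v))
    have := hL v hvN hmem
    rw [card_erase_of_mem hmem] at *
    omega
  have hsub : (T.erase (c v)) \ missing G c N T v ⊆ T := sdiff_subset.trans (erase_subset _ _)
  obtain ⟨T', hT', hm, B, hB, -, hsee, hv⟩ := hn G c N T hL {v} _ (by simp) hsub hcard (by
    intro w hw i hi
    obtain rfl := mem_singleton.1 hw
    obtain ⟨hi, hiD⟩ := mem_sdiff.1 hi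
    by_contra hno
    exact hiD (mem_missing.2 ⟨mem_of_mem_erase hi, hlt i hi, hno⟩))
  refine ⟨T', hT'.trans hsub, hm, B, hB, fun i hi => ?_, hsee⟩
  obtain ⟨u, hu, -, h⟩ := hv v (mem_singleton_self v) i hi
  exact ⟨u, hu, h⟩

/-! ### The number of colors of a wall in a `P₅`-free graph -/

/-- Suppose that for all colors `i < j` in `T` some neighbor of `x` of color `j` sees no neighbor
of `x` of color `i`. Then, in a `P₅`-free graph, the Grundy condition passes from `X` to the
non-neighbors of `x` in `X`. -/
theorem SeesLower.diff_neighborSet {V : Type*} {G : SimpleGraph V} {c : V → ℕ} {X : Set V}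
    {T : Finset ℕ} (hG : ¬ (SimpleGraph.pathGraph 5).IsIndContained G)
    (hc : ∀ u v, G.Adj u v → c u ≠ c v) (h : SeesLower G c X T) (x : V)
    (hbad : ∀ i ∈ T, ∀ j ∈ T, i < j → ∃ a ∈ X ∩ G.neighborSet x, c a = j ∧
      ¬ ∃ u ∈ X ∩ G.neighborSet x, G.Adj a u ∧ c u = i) :
    SeesLower G c (X \ G.neighborSet x) T := by
  rintro b ⟨hbX, hxb⟩ hbT i hi hib
  obtain ⟨w, hwX, hbw, hwi⟩ := h b hbX hbT i hi hib
  by_cases hxw : G.Adj x w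
  swap
  · exact ⟨w, ⟨hwX, hxw⟩, hbw, hwi⟩
  obtain ⟨a, ⟨haX, hxa⟩, hab, ha⟩ := hbad i hi _ hbT hib
  obtain ⟨z, hzX, haz, hzi⟩ := h a haX (hab ▸ hbT) i hi (hab ▸ hib)
  have hxz : ¬ G.Adj x z := fun hxz => ha ⟨z, ⟨hzX, hxz⟩, haz, hzi⟩
  refine ⟨z, ⟨hzX, hxz⟩, ?_, hzi⟩
  -- otherwise `b - w - x - a - z` is an induced path
  by_contra hbz
  refine hG (isIndContained_pathGraph_five hbw hxw.symm hxa haz (fun h => hxb h.symm)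
    (fun h => hc _ _ h hab.symm) hbz (fun h => ha ⟨w, ⟨hwX, hxw⟩, h.symm, hwi⟩)
    (fun h => hc _ _ h (hwi.trans hzi.symm)) hxz)

open Finset in
/-- In a `P₅`-free graph, the number of colors of a wall is bounded in terms of the clique
number. -/
theorem exists_bound_card_isWall (w : ℕ) : ∃ m : ℕ,
    ∀ {V : Type u} (G : SimpleGraph V) (c : V → ℕ) (X : Set V) (T : Finset ℕ),
    ¬ (SimpleGraph.pathGraph 5).IsIndContained G → (∀ u v, G.Adj u v → c u ≠ c v) →
    G.CliqueFreeOn X w → IsWall G c X T → #T ≤ m := by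
  classical
  induction w with
  | zero =>
    exact ⟨0, fun G c X T _ _ hX _ =>
      (hX (t := ∅) (by simp) (SimpleGraph.isNClique_empty.2 rfl)).elim⟩
  | succ w ih =>
    obtain ⟨m, hm⟩ := ih
    obtain ⟨n₁, hn₁⟩ := exists_ramsey_bound (m + 1) (m + 2)
    obtain ⟨n₂, hn₂⟩ := exists_isWall_of_card_missing_le.{u} n₁ (m + 1)
    obtain ⟨n₃, hn₃⟩ := exists_ramsey_bound (m + 1) n₂
    refine ⟨n₃, fun {V} G c X S hG hc hX hS => ?_⟩
    by_contra! hcard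
    -- walls inside a neighborhood have at most `m` colors by induction
    have hnbr : ∀ x ∈ X, ∀ Y ⊆ X ∩ G.neighborSet x, ∀ T : Finset ℕ, #T = m + 1 →
        ¬ IsWall G c Y T := fun x hx Y hY T hT hYT => by
      have := hm G c Y T hG hc ((hX.of_succ G hx).subset G hY) hYT
      omega
    have hne : S.Nonempty := card_pos.1 (by omega)
    have hlt : ∀ i ∈ S.erase (S.max' hne), i < S.max' hne := fun i hi =>
      S.lt_max'_of_mem_erase_max' hne hi
    have hmem := S.max'_mem hne
    generalize S.max' hne = s at *
    obtain ⟨x, hxX, rfl⟩ := hS.1 s hmem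
    set N := X ∩ G.neighborSet x with hN
    set M := X \ G.neighborSet x with hM
    have hNfull : ∀ i ∈ S.erase (c x), ∃ v ∈ N, c v = i := fun i hi => by
      obtain ⟨u, hu, hxu, h⟩ := hS.2 x hxX hmem i (mem_of_mem_erase hi) (hlt i hi)
      exact ⟨u, ⟨hu, hxu⟩, h⟩
    -- `y ∈ N(x)` sees many colors among the non-neighbors of `x`, and those form a wall
    obtain ⟨T₁, hT₁, hMT₁, y, hyN, hyT₁, hy⟩ : ∃ T₁ ⊆ S, SeesLower G c M T₁ ∧ ∃ y ∈ N,
        c y ∈ T₁ ∧ n₁ ≤ #(missing G c N T₁ y) := by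
      rcases hn₃ (fun i j => ∀ v ∈ N, c v = j → ∃ u ∈ N, G.Adj v u ∧ c u = i) (S.erase (c x))
        (by rw [card_erase_of_mem hmem]; omega) with ⟨T, hT, hTc, hgood⟩ | ⟨T, hT, hTc, hbad⟩
      · exact (hnbr x hxX N subset_rfl T hTc ⟨fun i hi => hNfull i (hT hi),
          fun v hv hvT i hi hiv => hgood i hi _ hvT hiv v hv rfl⟩).elim
      · refine ⟨T, hT.trans (erase_subset _ _), ?_, ?_⟩
        · refine (hS.2.subset (hT.trans (erase_subset _ _))).diff_neighborSet hG hc x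
            fun i hi j hj hij => ?_
          have := hbad i hi j hj hij
          push Not at this
          obtain ⟨v, hv, hvj, h⟩ := this
          exact ⟨v, hv, hvj, fun ⟨u, hu, hvu, hui⟩ => h u hu hvu hui⟩
        · by_contra! hno
          obtain ⟨T', hT', hcard', B, hB, hwall⟩ := hn₂ G c N T
            (fun i hi => hNfull i (hT hi)) (fun v hv hvT => (hno v hv hvT).le) hTc.ge
          exact hnbr x hxX B hB T' hcard' hwall
    set D := missing G c N T₁ y
    have hDT₁ : D ⊆ T₁ := fun i hi => (mem_missing.1 hi).1
    have hyM : ∀ i ∈ D, ∃ v ∈ M ∩ G.neighborSet y, c v = i := fun i hi => by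
      obtain ⟨hi, hiy, hno⟩ := mem_missing.1 hi
      obtain ⟨u, hu, hyu, hui⟩ := hS.2 y hyN.1 (hT₁ hyT₁) i (hT₁ hi) hiy
      exact ⟨u, ⟨⟨hu, fun hxu => hno ⟨u, ⟨hu, hxu⟩, hyu, hui⟩⟩, hyu⟩, hui⟩
    have hyX : ∀ v ∈ M ∩ G.neighborSet y, v ∈ X ∩ G.neighborSet y := fun v hv => ⟨hv.1.1, hv.2⟩
    rcases hn₁ (fun i j => ∀ v ∈ M ∩ G.neighborSet y, c v = j →
        ∃ u ∈ M ∩ G.neighborSet y, G.Adj v u ∧ c u = i) D hy with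
      ⟨T, hT, hTc, hgood⟩ | ⟨T, hT, hTc, hbad⟩
    · exact hnbr y hyN.1 _ hyX T hTc ⟨fun i hi => hyM i (hT hi),
        fun v hv hvT i hi hiv => hgood i hi _ hvT hiv v hv rfl⟩
    -- the non-neighbors of `y` in `M` satisfy the Grundy condition as well
    replace hbad : ∀ i ∈ T, ∀ j ∈ T, i < j → ∃ a ∈ M ∩ G.neighborSet y, c a = j ∧
        ¬ ∃ u ∈ M ∩ G.neighborSet y, G.Adj a u ∧ c u = i := fun i hi j hj hij => by
      have := hbad i hi j hj hij
      push Not at this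
      obtain ⟨v, hv, hvj, h⟩ := this
      exact ⟨v, hv, hvj, fun ⟨u, hu, hvu, hui⟩ => h u hu hvu hui⟩
    have hMT : SeesLower G c M T := hMT₁.subset (hT.trans hDT₁)
    have hU := hMT.diff_neighborSet hG hc y hbad
    have hTne : T.Nonempty := card_pos.1 (by omega)
    have hTlt : ∀ i ∈ T.erase (T.max' hTne), i < T.max' hTne := fun i hi =>
      T.lt_max'_of_mem_erase_max' hTne hi
    have hTmem := T.max'_mem hTne
    generalize T.max' hTne = l at *
    obtain hT₃ : #(T.erase l) = m + 1 := by rw [card_erase_of_mem hTmem]; omega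
    have hT₃ne : (T.erase l).Nonempty := card_pos.1 (by omega)
    have hkmax : ∀ i ∈ T.erase l, i ≤ (T.erase l).max' hT₃ne := fun i hi => le_max' _ i hi
    have hkmem := (T.erase l).max'_mem hT₃ne
    generalize (T.erase l).max' hT₃ne = k at *
    have hkT := mem_of_mem_erase hkmem
    obtain ⟨t, ⟨htM, hyt⟩, rfl, ht⟩ := hbad k hkT l hTmem (hTlt k hkmem)
    obtain ⟨q, hqM, htq, rfl⟩ := hMT t htM hTmem k hkT (hTlt k hkmem)
    have hq : q ∈ M \ G.neighborSet y := ⟨hqM, fun hyq => ht ⟨q, ⟨hqM, hyq⟩, htq, rfl⟩⟩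
    -- `N(t)` is closed under adjacency in `M \ N(y)`, since an edge `vu` leaving it would give
    -- the induced path `x - y - t - v - u`
    have hsee : SeesLower G c ((M \ G.neighborSet y) ∩ G.neighborSet t) (T.erase (c t)) := by
      rintro v ⟨hvU, htv⟩ hvT i hi hiv
      obtain ⟨u, huU, hvu, hui⟩ :=
        hU v hvU (mem_of_mem_erase hvT) i (mem_of_mem_erase hi) hiv
      refine ⟨u, ⟨huU, ?_⟩, hvu, hui⟩
      by_contra htu
      exact hG (isIndContained_pathGraph_five hyN.2 hyt htv hvu htM.2 hvU.1.2 huU.1.2 hvU.2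
        huU.2 htu)
    refine hnbr t htM.1 _ (fun v hv => ⟨hv.1.1.1, hv.2⟩) _ hT₃ ⟨fun i hi => ?_, hsee⟩
    rcases (hkmax i hi).eq_or_lt with rfl | hlt'
    · exact ⟨q, ⟨hq, htq⟩, rfl⟩
    · obtain ⟨u, hu, -, h⟩ := hsee q ⟨hq, htq⟩ hkmem i hi hlt'
      exact ⟨u, hu, h⟩

/-! ### The b-chromatic number is at least the clique number -/

theorem card_le_of_isColorDominatingColoring {V : Type*} [Fintype V] {G : SimpleGraph V} {k : ℕ}
    {C : G.Coloring (Fin k)} (hC : IsColorDominatingColoring C) : k ≤ Fintype.card V := by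
  simpa using Fintype.card_le_of_surjective C fun i => (hC i).imp fun _ h => h.1

/-- A proper coloring with the least number of colors is color-dominating: if no vertex of color `i`
saw all other colors, then color `i` could be eliminated by recoloring its vertices. -/
theorem exists_isColorDominatingColoring {V : Type*} [Finite V] (G : SimpleGraph V) :
    ∃ (n : ℕ) (C : G.Coloring (Fin n)), IsColorDominatingColoring C := by
  classical
  have := Fintype.ofFinite V
  have hex : ∃ n, G.Colorable n := ⟨_, G.selfColoring.colorable⟩
  obtain ⟨C⟩ := Nat.find_spec hex
  refine ⟨Nat.find hex, C, fun i => ?_⟩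
  by_contra! hno
  choose g hgne hg using hno
  let C' : G.Coloring {j // j ≠ i} := SimpleGraph.Coloring.mk
    (fun v => if h : C v = i then ⟨g v h, hgne v h⟩ else ⟨C v, h⟩) (by
      intro v w hvw heq
      by_cases hv : C v = i <;> by_cases hw : C w = i <;> simp only [hv, hw, dite_true,
        dite_false, Subtype.mk.injEq] at heq
      · exact C.valid hvw (hv.trans hw.symm)
      · exact hg v hv w hvw heq.symm
      · exact hg w hw v hvw.symm heq
      · exact C.valid hvw heq)
  have hmin := Nat.find_min' hex C'.colorable
  have hlt : Fintype.card {j // j ≠ i} < Fintype.card (Fin (Nat.find hex)) :=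
    Fintype.card_subtype_lt (x := i) (by simp)
  rw [Fintype.card_fin] at hlt
  omega

theorem cliqueFree_bChromaticNumber_succ {V : Type*} [Finite V] (G : SimpleGraph V) :
    G.CliqueFree (bChromaticNumber G + 1) := by
  have := Fintype.ofFinite V
  obtain ⟨n, C, hC⟩ := exists_isColorDominatingColoring G
  have hn : n ≤ bChromaticNumber G :=
    le_csSup ⟨_, fun k ⟨_, hC⟩ => card_le_of_isColorDominatingColoring hC⟩ ⟨C, hC⟩
  intro s hs
  have := hs.isClique.card_le_of_coloring C
  rw [hs.card_eq, Fintype.card_fin] at this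
  omega

theorem isGammaBBounded_forb_pathGraph_five :
    IsGammaBBounded (Forb.{u, 0} (SimpleGraph.pathGraph 5)) := by
  choose m hm using exists_bound_card_isWall.{u}
  refine ⟨fun n => m (n + 1), fun G hG => csSup_le' ?_⟩
  rintro k ⟨C, hsurj, hC⟩
  have := G.finite
  have hwall : IsWall G.graph (fun v => (C v : ℕ)) Set.univ (Finset.range k) := by
    refine ⟨fun i hi => ?_, fun v _ _ i hi hiv => ?_⟩
    · obtain ⟨v, hv⟩ := hsurj ⟨i, Finset.mem_range.1 hi⟩
      exact ⟨v, trivial, by simp [hv]⟩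
    · obtain ⟨w, hvw, hw⟩ := hC ⟨i, Finset.mem_range.1 hi⟩ (C v) hiv v rfl
      exact ⟨w, trivial, hvw, by simp [hw]⟩
  simpa using hm (bChromaticNumber G.graph + 1) G.graph _ _ _ hG
    (fun u v huv h => C.valid huv (Fin.ext h))
    ((cliqueFree_bChromaticNumber_succ G.graph).cliqueFreeOn _) hwall

theorem isIndContained_pathGraph_of_le {m n : ℕ} (h : m ≤ n) :
    (SimpleGraph.pathGraph m).IsIndContained (SimpleGraph.pathGraph n) :=
  ⟨⟨(Fin.castLEEmb h), by simp [SimpleGraph.pathGraph_adj]⟩⟩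

/-! ### The graph `K_{t,t}` minus a matching of size `t - 1` -/

section BipartiteMinusMatching

variable {t : ℕ}

/-- The position of a vertex of `K_{t,t}` within its side. -/
def sideIndex (v : Fin t ⊕ Fin t) : Fin t := Sum.elim id id v

theorem ext_side {v w : Fin t ⊕ Fin t} (h : v.isLeft = w.isLeft)
    (hi : sideIndex v = sideIndex w) : v = w := by
  rcases v with v | v <;> rcases w with w | w <;> simp_all [sideIndex]

theorem bipartiteMinusMatching_adj {v w : Fin t ⊕ Fin t} :
    (bipartiteMinusMatching t).Adj v w ↔ v.isLeft ≠ w.isLeft ∧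
      ¬ (sideIndex v = sideIndex w ∧ (sideIndex v : ℕ) + 1 < t) := by
  rcases v with v | v <;> rcases w with w | w <;>
    simp [bipartiteMinusMatching, completeBipartiteGraph, sideIndex] <;> grind

/-- In an induced `P₆`, the first vertex is non-adjacent to the fourth and the sixth, both on the
other side; but each vertex has at most one non-neighbor on the other side. -/
theorem not_isIndContained_bipartiteMinusMatching {k : ℕ} (hk : 6 ≤ k) :
    ¬ (SimpleGraph.pathGraph k).IsIndContained (bipartiteMinusMatching t) := by
  rintro ⟨f⟩
  let p : Fin 6 → Fin t ⊕ Fin t := fun i => f (Fin.castLE hk i)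
  have hadj : ∀ i j : Fin 6, (bipartiteMinusMatching t).Adj (p i) (p j) ↔
      ((i : ℕ) + 1 = j ∨ (j : ℕ) + 1 = i) := fun i j => by
    rw [f.map_adj_iff, SimpleGraph.pathGraph_adj]; simp
  have hside : ∀ i j : Fin 6, (i : ℕ) + 1 = j → (p i).isLeft ≠ (p j).isLeft := fun i j h =>
    (bipartiteMinusMatching_adj.1 ((hadj i j).2 (.inl h))).1
  have hindex : ∀ i j : Fin 6, (p i).isLeft ≠ (p j).isLeft →
      ¬ ((i : ℕ) + 1 = j ∨ (j : ℕ) + 1 = i) → sideIndex (p i) = sideIndex (p j) := by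
    intro i j hs h
    rw [← hadj, bipartiteMinusMatching_adj] at h
    tauto
  have h₀₁ := hside 0 1 rfl
  have h₁₂ := hside 1 2 rfl
  have h₂₃ := hside 2 3 rfl
  have h₃₄ := hside 3 4 rfl
  have h₄₅ := hside 4 5 rfl
  have h₃ := hindex 0 3 (by grind) (by decide)
  have h₅ := hindex 0 5 (by grind) (by decide)
  have h₃₅ : p 3 = p 5 := ext_side (by grind) (h₃.symm.trans h₅)
  have := f.injective h₃₅
  simp [Fin.ext_iff] at this

theorem le_of_isGrundyColoring_bipartiteMinusMatching {k : ℕ}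
    {C : (bipartiteMinusMatching t).Coloring (Fin k)} (hC : IsGrundyColoring C) : k ≤ t + 1 := by
  obtain ⟨hsurj, hC⟩ := hC
  rcases k with _ | k
  · omega
  -- the neighbors of a vertex of the largest color lie on one side of size `t`
  obtain ⟨v, hv⟩ := hsurj (Fin.last k)
  choose w hvw hw using fun i : Fin k => hC i.castSucc (Fin.last k) i.castSucc_lt_last v hv
  have hinj : Function.Injective fun i => sideIndex (w i) := fun i j hij => by
    have hi := (bipartiteMinusMatching_adj.1 (hvw i)).1
    have hj := (bipartiteMinusMatching_adj.1 (hvw j)).1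
    have := congrArg C (ext_side (by grind) hij)
    rwa [hw, hw, Fin.castSucc_inj] at this
  simpa using Fintype.card_le_of_injective _ hinj

/-- The two vertices separated by the `i`-th edge of the removed matching get color `i`, and the two
remaining vertices get one further color each. -/
theorem exists_isGrundyColoring_bipartiteMinusMatching (ht : 2 ≤ t) :
    ∃ C : (bipartiteMinusMatching t).Coloring (Fin (t + 1)), IsGrundyColoring C := by
  refine ⟨SimpleGraph.Coloring.mk (Sum.elim Fin.castSucc fun j =>
    if (j : ℕ) + 1 < t then j.castSucc else Fin.last t) ?_, ?_, ?_⟩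
  · rintro (v | v) (w | w) h <;> rw [bipartiteMinusMatching_adj] at h <;>
      simp [sideIndex, Fin.ext_iff] at h ⊢ <;> grind
  · intro i
    induction i using Fin.lastCases with
    | last => exact ⟨.inr ⟨t - 1, by omega⟩, if_neg (by simp; omega)⟩
    | cast i => exact ⟨.inl i, rfl⟩
  · rintro i j hij (v | v) rfl
    · have hiv : (i : ℕ) < v := hij
      refine ⟨.inr ⟨i, by omega⟩, ?_, ?_⟩
      · rw [bipartiteMinusMatching_adj]
        simp [sideIndex, Fin.ext_iff]
        omega
      · exact (if_pos (by simp; omega)).trans (Fin.ext rfl)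
    · have hiv : i < if (v : ℕ) + 1 < t then v.castSucc else Fin.last t := hij
      have hit : (i : ℕ) < t ∧ ((v : ℕ) + 1 < t → (i : ℕ) < v) := by
        split_ifs at hiv with h <;> have := Fin.lt_def.1 hiv <;> simp at this <;> omega
      refine ⟨.inl ⟨i, hit.1⟩, ?_, Fin.ext rfl⟩
      rw [bipartiteMinusMatching_adj]
      simp [sideIndex, Fin.ext_iff]
      omega

theorem grundyNumber_bipartiteMinusMatching (ht : 2 ≤ t) :
    grundyNumber (bipartiteMinusMatching t) = t + 1 :=
  le_antisymm (csSup_le' fun _ ⟨_, hC⟩ => le_of_isGrundyColoring_bipartiteMinusMatching hC)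
    (le_csSup ⟨t + 1, fun _ ⟨_, hC⟩ => le_of_isGrundyColoring_bipartiteMinusMatching hC⟩
      (exists_isGrundyColoring_bipartiteMinusMatching ht))

/-- The last vertex of each side is adjacent to the whole other side, so its color does not occur
there. A vertex of a third color therefore misses the color of the last vertex of its own side. -/
theorem le_of_isColorDominatingColoring_bipartiteMinusMatching (ht : 2 ≤ t) {k : ℕ}
    {C : (bipartiteMinusMatching t).Coloring (Fin k)} (hC : IsColorDominatingColoring C) :
    k ≤ 2 := by
  classical
  by_contra! hk
  let l : Fin t := ⟨t - 1, by omega⟩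
  have hl : (l : ℕ) + 1 = t := by simp [l]; omega
  obtain ⟨c, hc⟩ : ∃ c, c ∉ ({C (.inl l), C (.inr l)} : Finset (Fin k)) := by
    by_contra! hall
    have := Finset.card_le_card (fun c _ => hall c : Finset.univ ⊆ _)
    have := Finset.card_le_two (a := C (.inl l)) (b := C (.inr l))
    simp at *
    omega
  simp only [Finset.mem_insert, Finset.mem_singleton, not_or] at hc
  obtain ⟨v, -, hdom⟩ := hC c
  rcases v with v | v
  · obtain ⟨w, hvw, hw⟩ := hdom _ (Ne.symm hc.1)
    refine C.valid (v := Sum.inl l) (w := w) ?_ hw.symm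
    rw [bipartiteMinusMatching_adj] at hvw ⊢
    exact ⟨hvw.1, fun h => by simp [sideIndex] at h; omega⟩
  · obtain ⟨w, hvw, hw⟩ := hdom _ (Ne.symm hc.2)
    refine C.valid (v := Sum.inr l) (w := w) ?_ hw.symm
    rw [bipartiteMinusMatching_adj] at hvw ⊢
    exact ⟨hvw.1, fun h => by simp [sideIndex] at h; omega⟩

theorem exists_isColorDominatingColoring_bipartiteMinusMatching (ht : 2 ≤ t) :
    ∃ C : (bipartiteMinusMatching t).Coloring (Fin 2), IsColorDominatingColoring C := by
  let l : Fin t := ⟨t - 1, by omega⟩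
  have hl : (l : ℕ) + 1 = t := by simp [l]; omega
  have hadj : (bipartiteMinusMatching t).Adj (.inl l) (.inr l) := by
    rw [bipartiteMinusMatching_adj]
    simp [sideIndex, hl]
  refine ⟨SimpleGraph.Coloring.mk (Sum.elim (fun _ => 0) fun _ => 1) ?_, fun i => ?_⟩
  · rintro (v | v) (w | w) h <;> rw [bipartiteMinusMatching_adj] at h <;> simp at h ⊢
  · fin_cases i
    · exact ⟨.inl l, rfl, fun j hj => ⟨.inr l, hadj, (Fin.eq_one_of_ne_zero j hj).symm⟩⟩
    · refine ⟨.inr l, rfl, fun j hj => ⟨.inl l, hadj.symm, ?_⟩⟩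
      by_contra h
      exact hj (Fin.eq_one_of_ne_zero j (Ne.symm h))

theorem bChromaticNumber_bipartiteMinusMatching (ht : 2 ≤ t) :
    bChromaticNumber (bipartiteMinusMatching t) = 2 :=
  le_antisymm
    (csSup_le' fun _ ⟨_, hC⟩ => le_of_isColorDominatingColoring_bipartiteMinusMatching ht hC)
    (le_csSup ⟨2, fun _ ⟨_, hC⟩ => le_of_isColorDominatingColoring_bipartiteMinusMatching ht hC⟩
      (exists_isColorDominatingColoring_bipartiteMinusMatching ht))

end BipartiteMinusMatching

/-! ### Invariance under isomorphism -/

section Iso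

variable {V : Type*} {W : Type*} {G : SimpleGraph V} {H : SimpleGraph W}

theorem IsGrundyColoring.comp_iso {k : ℕ} {C : H.Coloring (Fin k)} (hC : IsGrundyColoring C)
    (e : G ≃g H) : ∃ C' : G.Coloring (Fin k), IsGrundyColoring C' := by
  refine ⟨C.comp e.toHom, hC.1.comp e.surjective, fun i j hij v hv => ?_⟩
  obtain ⟨w, hw, h⟩ := hC.2 i j hij (e v) hv
  exact ⟨e.symm w, by rw [← e.map_adj_iff]; simpa using hw, by simpa using h⟩

theorem IsColorDominatingColoring.comp_iso {k : ℕ} {C : H.Coloring (Fin k)}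
    (hC : IsColorDominatingColoring C) (e : G ≃g H) :
    ∃ C' : G.Coloring (Fin k), IsColorDominatingColoring C' := by
  refine ⟨C.comp e.toHom, fun i => ?_⟩
  obtain ⟨v, hv, hdom⟩ := hC i
  refine ⟨e.symm v, by simpa using hv, fun j hj => ?_⟩
  obtain ⟨w, hw, h⟩ := hdom j hj
  exact ⟨e.symm w, by rw [← e.map_adj_iff]; simpa using hw, by simpa using h⟩

theorem grundyNumber_congr (e : G ≃g H) : grundyNumber G = grundyNumber H :=
  congrArg sSup (Set.ext fun _ => ⟨fun ⟨_, h⟩ => h.comp_iso e.symm, fun ⟨_, h⟩ => h.comp_iso e⟩)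

theorem bChromaticNumber_congr (e : G ≃g H) : bChromaticNumber G = bChromaticNumber H :=
  congrArg sSup (Set.ext fun _ => ⟨fun ⟨_, h⟩ => h.comp_iso e.symm, fun ⟨_, h⟩ => h.comp_iso e⟩)

end Iso

theorem not_isGammaBBounded_forb_pathGraph {k : ℕ} (hk : 6 ≤ k) :
    ¬ IsGammaBBounded (Forb.{u, 0} (SimpleGraph.pathGraph k)) := by
  rintro ⟨f, hf⟩
  let t := f 2 + 2
  -- the vertices of `B_t` are lifted to the universe of the family
  let e : (bipartiteMinusMatching t).comap (Equiv.ulift.{u}) ≃g bipartiteMinusMatching t :=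
    SimpleGraph.Iso.comap Equiv.ulift _
  have := hf ⟨ULift.{u} (Fin t ⊕ Fin t), inferInstance, (bipartiteMinusMatching t).comap _⟩
    fun h => not_isIndContained_bipartiteMinusMatching hk (h.trans ⟨e.toEmbedding⟩)
  rw [grundyNumber_congr e, bChromaticNumber_congr e,
    grundyNumber_bipartiteMinusMatching (by omega),
    bChromaticNumber_bipartiteMinusMatching (by omega)] at this
  omega

theorem mainTheorem2 :
    (∀ k : ℕ, IsGammaBBounded (Forb.{u, 0} (SimpleGraph.pathGraph k)) ↔ k ≤ 5) ∧
    (∀ t : ℕ, 2 ≤ t →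
      (∀ k : ℕ, 6 ≤ k →
        ¬ SimpleGraph.IsIndContained (SimpleGraph.pathGraph k) (bipartiteMinusMatching t)) ∧
      grundyNumber (bipartiteMinusMatching t) = t + 1 ∧
      bChromaticNumber (bipartiteMinusMatching t) = 2) := by
  refine ⟨fun k => ⟨fun h => ?_, fun h => ?_⟩, fun t ht =>
    ⟨fun k hk => not_isIndContained_bipartiteMinusMatching hk,
      grundyNumber_bipartiteMinusMatching ht, bChromaticNumber_bipartiteMinusMatching ht⟩⟩
  · by_contra! hk
    exact not_isGammaBBounded_forb_pathGraph hk h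
  · obtain ⟨f, hf⟩ := isGammaBBounded_forb_pathGraph_five.{u}
    exact ⟨f, fun G hG => hf G fun h5 => hG ((isIndContained_pathGraph_of_le h).trans h5)⟩
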